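/- For $n\ge 0$ let $\Pi_n$ be the set of partitions of $[n]=\{1,\dots,n\}$ into disjoint nonempty blocks (so $|\Pi_0|=1$). An edge of $\pi\in\Pi_n$ is a pair $(i,j)$ with $i<j$ such that $i$ and $j$ are consecutive elements of a block of $\pi$. Let $\mathrm{cr}(\pi)$ be the number of crossings of $\pi$, i.e. of pairs of edges $(i_1,j_1),(i_2,j_2)$ with $i_1<i_2<j_1<j_2$, and $\mathrm{ne}(\pi)$ the number of nestings, i.e. of pairs of edges with $i_1<i_2<j_2<j_1$. Let $\mathrm{sg}(\pi)$ be the number of singleton blocks, $\mathrm{bl}(\pi)$ the number of blocks with at least two elements, and $\mathrm{tr}(\pi)$ the number of transients, i.e. of elements that are neither the least nor the greatest element of their block, the block having at least two elements. Let $p,q,u_1,u_2,v$ be elements of a commutative ring $R$ (for instance indeterminates) and put $$B_n(p,q,u_1,u_2,v)=\sum_{\pi\in\Pi_n}p^{\mathrm{cr}(\pi)}q^{\mathrm{ne}(\pi)}u_1^{\mathrm{sg}(\pi)}u_2^{\mathrm{bl}(\pi)}v^{\mathrm{tr}(\pi)},\qquad [k]_{p,q}=\frac{p^k-q^k}{p-q}=\sum_{i=0}^{k-1}p^iq^{k-1-i}.$$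 (If $p-q$ is not invertible, $[k]_{p,q}$ means the sum on the right.) **Proposition.** In $R[[z]]$, the generating function has the continued fraction expansion $$\sum_{n\ge 0}B_n(p,q,u_1,u_2,v)\,z^n=\cfrac{1}{1-u_1z-\cfrac{u_2z^2}{1-(u_1+v)z-\cfrac{u_2[2]_{p,q}z^2}{1-(u_1+[2]_{p,q}v)z-\cfrac{u_2[3]_{p,q}z^2}{\ddots}}}}$$ with partial denominators $1-(u_1+[k]_{p,q}v)z$ and partial numerators $u_2[k+1]_{p,q}z^2$ for $k\ge 0$. That is, for every $n$, the coefficient of $z^n$ in the convergent with $d$ levels (the continued fraction cut off after the denominator $1-(u_1+[d-1]_{p,q}v)z$) equals $B_n(p,q,u_1,u_2,v)$ for all sufficiently large $d$. -/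

import Mathlib

/-- The set partitions of `[n] = {1, …, n}` (blocks are nonempty and pairwise disjoint). -/
abbrev SetPartition (n : ℕ) : Type := Finpartition (Finset.Icc 1 n)

namespace SetPartition

variable {n : ℕ}

/-- The edges `(i, j)` of the partition graph: `i < j` are consecutive elements of a block. -/
def edges (π : SetPartition n) : Finset (ℕ × ℕ) :=
  (Finset.Icc 1 n ×ˢ Finset.Icc 1 n).filter fun e =>
    e.1 < e.2 ∧ ∃ B ∈ π.parts, e.1 ∈ B ∧ e.2 ∈ B ∧ ∀ x ∈ B, ¬(e.1 < x ∧ x < e.2)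

/-- The number of crossings: pairs of edges with `i₁ < i₂ < j₁ < j₂`. -/
def cr (π : SetPartition n) : ℕ :=
  ((π.edges ×ˢ π.edges).filter fun e =>
    e.1.1 < e.2.1 ∧ e.2.1 < e.1.2 ∧ e.1.2 < e.2.2).card

/-- The number of nestings: pairs of edges with `i₁ < i₂ < j₂ < j₁`. -/
def ne (π : SetPartition n) : ℕ :=
  ((π.edges ×ˢ π.edges).filter fun e =>
    e.1.1 < e.2.1 ∧ e.2.1 < e.2.2 ∧ e.2.2 < e.1.2).card

/-- The number of singletons. -/
def sg (π : SetPartition n) : ℕ :=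
  ((Finset.Icc 1 n).filter fun x => {x} ∈ π.parts).card

/-- The number of blocks with at least two elements. -/
def bl (π : SetPartition n) : ℕ :=
  (π.parts.filter fun B => 2 ≤ B.card).card

/-- The number of transients: elements that are neither the least nor the greatest element of
their block, the block having at least two elements. -/
def tr (π : SetPartition n) : ℕ :=
  ((Finset.Icc 1 n).filter fun x =>
    ∃ B ∈ π.parts, 2 ≤ B.card ∧ x ∈ B ∧ (∃ y ∈ B, y < x) ∧ (∃ y ∈ B, x < y)).card

end SetPartition

/-- The enumerating polynomial `B_n(p, q, u₁, u₂, v)` of the set partitions of `[n]`, with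
arguments in a commutative ring (possibly indeterminates). -/
def bellPoly {R : Type*} [CommRing R] (p q u₁ u₂ v : R) (n : ℕ) : R :=
  ∑ π : SetPartition n, p ^ π.cr * q ^ π.ne * u₁ ^ π.sg * u₂ ^ π.bl * v ^ π.tr

/-- `[k]_{p,q} = (p ^ k - q ^ k) / (p - q)`, expanded as the homogeneous polynomial
`p ^ (k - 1) + p ^ (k - 2) * q + ⋯ + q ^ (k - 1)`, so that it makes sense in every commutative
ring; in the sum `k - 1 - i` never truncates because `i < k`. -/
def pqNumber {R : Type*} [CommRing R] (p q : R) (k : ℕ) : R :=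
  ∑ i ∈ Finset.range k, p ^ i * q ^ (k - 1 - i)

theorem pqNumber_mul_sub {R : Type*} [CommRing R] (p q : R) (k : ℕ) :
    pqNumber p q k * (p - q) = p ^ k - q ^ k :=
  (Commute.all p q).geom_sum₂_mul k

theorem pqNumber_eq_div {K : Type*} [Field K] (p q : K) (h : p ≠ q) (k : ℕ) :
    pqNumber p q k = (p ^ k - q ^ k) / (p - q) :=
  eq_div_of_mul_eq (sub_ne_zero.mpr h) (pqNumber_mul_sub p q k)

/-- `jFractionAux b c d m` is the finite continued fraction with `d` levels, starting at level `m`: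
`1 / (1 - b m z - c m z² / (1 - b (m+1) z - c (m+1) z² / (⋯ / (1 - b (m+d-1) z))))`
as a formal power series in `z`. Each denominator has constant coefficient `1`, so that
`PowerSeries.invOfUnit _ 1` is its inverse, see `denominator_mul_jFractionAux`. -/
noncomputable def jFractionAux {R : Type*} [CommRing R] (b c : ℕ → R) : ℕ → ℕ → PowerSeries R
  | 0, _ => 0
  | d + 1, m =>
      PowerSeries.invOfUnit
        (1 - PowerSeries.C (b m) * PowerSeries.X
          - PowerSeries.C (c m) * PowerSeries.X ^ 2 * jFractionAux b c d (m + 1)) 1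

theorem denominator_mul_jFractionAux {R : Type*} [CommRing R] (b c : ℕ → R) (d m : ℕ) :
    (1 - PowerSeries.C (b m) * PowerSeries.X
      - PowerSeries.C (c m) * PowerSeries.X ^ 2 * jFractionAux b c d (m + 1))
      * jFractionAux b c (d + 1) m = 1 := by
  rw [jFractionAux]
  exact PowerSeries.mul_invOfUnit _ 1 (by simp)

/-- The `d`-th convergent of the infinite J-fraction
`1 / (1 - b 0 z - c 0 z² / (1 - b 1 z - c 1 z² / (1 - b 2 z - ⋯)))`. -/
noncomputable def jFractionConvergent {R : Type*} [CommRing R] (b c : ℕ → R) (d : ℕ) :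
    PowerSeries R :=
  jFractionAux b c d 0

/-- The formal power series `F` is the value of the infinite J-fraction with denominators
`1 - b k z` and numerators `c k z²`: its convergents converge to `F` as formal power series, that
is, every coefficient is eventually equal to that of `F`. -/
def HasJFraction {R : Type*} [CommRing R] (F : PowerSeries R) (b c : ℕ → R) : Prop :=
  ∀ n : ℕ, ∀ᶠ d in Filter.atTop,
    PowerSeries.coeff n (jFractionConvergent b c d) = PowerSeries.coeff n F

/-!
Read the elements of `[n]` from left to right. A set partition in which some blocks are marked as
still open is an arc diagram with a half-arc at the greatest element of each open block, and the
number of half-arcs is the height of a Motzkin path. A new greatest point `m` is isolated (weight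
`u₁`), starts a half-arc (weight `1`), or turns a half-arc that starts at `a` into an arc from `a`
to `m`; in the last case it either starts nothing (weight `u₂`) or a new half-arc (weight `v`).
The half-arcs that start at some `o ≠ a` will end to the right of `m`, so the new arc crosses
those with `a < o` and is nested under those with `o < a`. Summing
`p ^ #{o | a < o} * q ^ #{o | o < a}` over the `k` choices of `a` gives `[k]_{p,q}`. Thus `B_n`
counts weighted Motzkin paths of length `n` from height `0` to height `0`, and the generating
function of these is the J-fraction of the step weights (Flajolet).
-/

open Finset

section MotzkinPaths

/-- The weighted number of Motzkin paths of length `n` from height `0` to height `k`, where a level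
step at height `i` has weight `b i`, a down step from height `i + 1` has weight `c i`, and up steps
have weight `1`. -/
def motzkinSum {R : Type*} [Semiring R] (b c : ℕ → R) : ℕ → ℕ → R
  | 0, 0 => 1
  | 0, _ + 1 => 0
  | n + 1, 0 => b 0 * motzkinSum b c n 0 + c 0 * motzkinSum b c n 1
  | n + 1, k + 1 => motzkinSum b c n k + b (k + 1) * motzkinSum b c n (k + 1) +
      c (k + 1) * motzkinSum b c n (k + 2)

variable {R : Type*} [CommRing R] (b c : ℕ → R) {d k : ℕ}

/-- The power series `z ^ k J₀ J₁ ⋯ J_k`, where `J_i` is the J-fraction that starts at level `i` and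
is cut off before level `d`: the generating function, by length, of the weighted Motzkin paths to
height `k` that stay below height `d`. -/
noncomputable def jFractionProd (d k : ℕ) : PowerSeries R :=
  PowerSeries.X ^ k * ∏ i ∈ range (k + 1), jFractionAux b c (d - i) i

theorem jFractionAux_succ_eq (d m : ℕ) :
    jFractionAux b c (d + 1) m =
      1 + PowerSeries.X * (PowerSeries.C (b m) * jFractionAux b c (d + 1) m +
        PowerSeries.C (c m) * (PowerSeries.X *
          (jFractionAux b c (d + 1) m * jFractionAux b c d (m + 1)))) := by
  linear_combination denominator_mul_jFractionAux b c d m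

theorem jFractionProd_zero (hd : 0 < d) :
    jFractionProd b c d 0 = 1 + PowerSeries.X * (PowerSeries.C (b 0) * jFractionProd b c d 0 +
      PowerSeries.C (c 0) * jFractionProd b c d 1) := by
  obtain ⟨d, rfl⟩ := Nat.exists_eq_add_of_lt hd
  have h := jFractionAux_succ_eq b c d 0
  simp only [jFractionProd, prod_range_succ, range_zero, prod_empty, pow_zero, pow_one, one_mul,
    zero_add, Nat.sub_zero, Nat.add_sub_cancel] at h ⊢
  linear_combination h

theorem jFractionProd_succ (hd : k + 1 < d) :
    jFractionProd b c d (k + 1) = PowerSeries.X * (jFractionProd b c d k +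
      PowerSeries.C (b (k + 1)) * jFractionProd b c d (k + 1) +
      PowerSeries.C (c (k + 1)) * jFractionProd b c d (k + 2)) := by
  obtain ⟨e, rfl⟩ := Nat.exists_eq_add_of_lt hd
  have h := jFractionAux_succ_eq b c e (k + 1)
  simp only [jFractionProd]
  rw [prod_range_succ _ (k + 2), prod_range_succ _ (k + 1),
    show k + 1 + e + 1 - (k + 1) = e + 1 by omega, show k + 1 + e + 1 - (k + 2) = e by omega]
  linear_combination
    (PowerSeries.X ^ (k + 1) * ∏ i ∈ range (k + 1), jFractionAux b c (k + 1 + e + 1 - i) i) * h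

theorem coeff_jFractionProd {n : ℕ} (h : n + k < d) :
    PowerSeries.coeff n (jFractionProd b c d k) = motzkinSum b c n k := by
  induction n, k using motzkinSum.induct with
  | case1 => rw [jFractionProd_zero b c (by omega)]; simp [motzkinSum]
  | case2 k => rw [jFractionProd_succ b c (by omega)]; simp [motzkinSum]
  | case3 n ih₀ ih₁ =>
    rw [jFractionProd_zero b c (by omega), map_add, PowerSeries.coeff_succ_X_mul,
      PowerSeries.coeff_one, if_neg n.succ_ne_zero, zero_add, map_add, PowerSeries.coeff_C_mul,
      PowerSeries.coeff_C_mul, ih₀ (by omega), ih₁ (by omega), motzkinSum]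
  | case4 n k ih₀ ih₁ ih₂ =>
    rw [jFractionProd_succ b c (by omega), PowerSeries.coeff_succ_X_mul, map_add, map_add,
      PowerSeries.coeff_C_mul, PowerSeries.coeff_C_mul, ih₀ (by omega), ih₁ (by omega),
      ih₂ (by omega), motzkinSum]

theorem hasJFraction_motzkinSum :
    HasJFraction (PowerSeries.mk fun n => motzkinSum b c n 0) b c := by
  intro n
  filter_upwards [Filter.eventually_gt_atTop n] with d hd
  simpa [jFractionProd, jFractionConvergent] using coeff_jFractionProd b c (k := 0) hd

end MotzkinPaths

section Sums

theorem sum_pow_card_gt_mul_pow_card_lt {R α : Type*} [CommRing R] [LinearOrder α] (p q : R)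
    (s : Finset α) :
    ∑ a ∈ s, p ^ #{x ∈ s | a < x} * q ^ #{x ∈ s | x < a} = pqNumber p q #s := by
  induction s using Finset.induction_on_min with
  | empty => simp [pqNumber]
  | insert m s hm ih =>
    have hms : m ∉ s := fun h => (hm m h).false
    have hsucc : pqNumber p q (#s + 1) = p ^ #s + q * pqNumber p q #s :=
      geom_sum₂_succ_eq p q
    rw [sum_insert hms, card_insert_of_notMem hms, hsucc, ← ih, mul_sum]
    congr 1
    · rw [filter_insert, if_neg (lt_irrefl m), filter_insert, if_neg (lt_irrefl m),
        filter_true_of_mem hm, filter_false_of_mem fun x hx => (hm x hx).not_gt, card_empty,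
        pow_zero, mul_one]
    · refine sum_congr rfl fun a ha => ?_
      rw [filter_insert, if_neg (hm a ha).not_gt, filter_insert, if_pos (hm a ha),
        card_insert_of_notMem (by simp [hms]), pow_succ', mul_left_comm]

variable {α M : Type*} [DecidableEq α] [AddCommMonoid M]

theorem sum_powersetCard_succ_insert {a : α} {s : Finset α} (ha : a ∉ s) (k : ℕ)
    (f : Finset α → M) :
    ∑ t ∈ powersetCard (k + 1) (insert a s), f t =
      ∑ t ∈ powersetCard (k + 1) s, f t + ∑ t ∈ powersetCard k s, f (insert a t) := by
  have hnot {k : ℕ} {t : Finset α} (ht : t ∈ powersetCard k s) : a ∉ t :=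
    fun hat => ha ((mem_powersetCard.1 ht).1 hat)
  rw [powersetCard_succ_insert ha, sum_union, sum_image]
  · exact fun t ht u hu htu => by
      rw [← erase_insert (hnot ht), ← erase_insert (hnot hu), htu]
  · refine disjoint_left.2 fun t ht ht' => ?_
    obtain ⟨u, -, rfl⟩ := mem_image.1 ht'
    exact hnot ht (mem_insert_self a u)

theorem sum_sum_powersetCard_erase (s : Finset α) (k : ℕ) (f : α → Finset α → M) :
    ∑ a ∈ s, ∑ t ∈ powersetCard k (s.erase a), f a t =
      ∑ t ∈ powersetCard (k + 1) s, ∑ a ∈ t, f a (t.erase a) := by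
  have hnot {a : α} {t : Finset α} (ht : t ∈ powersetCard k (s.erase a)) : a ∉ t :=
    fun hat => notMem_erase a s ((mem_powersetCard.1 ht).1 hat)
  rw [sum_sigma', sum_sigma']
  refine sum_bij' (fun x _ => ⟨insert x.1 x.2, x.1⟩) (fun x _ => ⟨x.2, x.1.erase x.2⟩)
    ?_ ?_ ?_ ?_ ?_ <;> rintro ⟨x, y⟩ h <;> rw [mem_sigma] at h
  · rw [mem_sigma, mem_powersetCard]
    grind
  · rw [mem_sigma, mem_powersetCard]
    grind
  · rw [erase_insert (hnot h.2)]
  · simp only [insert_erase h.2]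
  · rw [erase_insert (hnot h.2)]

end Sums

section Counting

variable {β γ : Type*}

theorem card_filter_insert_product_insert [DecidableEq β] {s : Finset β} {x : β} (hx : x ∉ s)
    (r : β → β → Prop) [DecidableRel r] (hr : ¬ r x x) :
    #{y ∈ insert x s ×ˢ insert x s | r y.1 y.2} =
      #{y ∈ s ×ˢ s | r y.1 y.2} + #{y ∈ s | r y x} + #{y ∈ s | r x y} := by
  simp only [card_filter, sum_product, sum_insert hx, sum_add_distrib, if_neg hr]
  omega

theorem card_filter_insert_product [DecidableEq β] {s : Finset β} {x : β} (hx : x ∉ s)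
    (t : Finset γ) (r : β → γ → Prop) [∀ y z, Decidable (r y z)] :
    #{y ∈ insert x s ×ˢ t | r y.1 y.2} = #{y ∈ s ×ˢ t | r y.1 y.2} + #{z ∈ t | r x z} := by
  simp only [card_filter, sum_product, sum_insert hx]
  omega

theorem card_filter_product_erase_add [DecidableEq γ] (s : Finset β) {t : Finset γ} {z : γ}
    (hz : z ∈ t) (r : β → γ → Prop) [∀ y z, Decidable (r y z)] :
    #{y ∈ s ×ˢ t.erase z | r y.1 y.2} + #{y ∈ s | r y z} = #{y ∈ s ×ˢ t | r y.1 y.2} := by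
  simp only [card_filter, sum_product, ← sum_add_distrib]
  exact sum_congr rfl fun y _ => sum_erase_add t _ hz

end Counting

section ArcDiagrams

variable {α : Type*} [LinearOrder α]

/-- The number of crossings of the arc diagram with arcs `E` and half-arcs starting at the points
of `O`. A half-arc counts as ending to the right of all points, so it crosses the arcs under which
it starts; pairs of half-arcs are not counted, since nothing says which of them ends first. -/
def diagramCr (E : Finset (α × α)) (O : Finset α) : ℕ :=
  #{e ∈ E ×ˢ E | e.1.1 < e.2.1 ∧ e.2.1 < e.1.2 ∧ e.1.2 < e.2.2} +
    #{x ∈ E ×ˢ O | x.1.1 < x.2 ∧ x.2 < x.1.2}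

/-- The number of nestings of the arc diagram with arcs `E` and half-arcs starting at the points of
`O`: a half-arc covers the arcs that start to the right of it. -/
def diagramNe (E : Finset (α × α)) (O : Finset α) : ℕ :=
  #{e ∈ E ×ˢ E | e.1.1 < e.2.1 ∧ e.2.1 < e.2.2 ∧ e.2.2 < e.1.2} + #{x ∈ E ×ˢ O | x.2 < x.1.1}

variable {s : Finset α} {E : Finset (α × α)} {O : Finset α} {a m : α}

theorem diagramCr_insert_halfArc (hE : ∀ e ∈ E, e.2 ≤ m) :
    diagramCr E (insert m O) = diagramCr E O := by
  unfold diagramCr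
  congr 2
  grind

theorem diagramNe_insert_halfArc (hE : ∀ e ∈ E, e.1 ≤ m) :
    diagramNe E (insert m O) = diagramNe E O := by
  unfold diagramNe
  congr 2
  grind

theorem diagramCr_close (hE : ∀ e ∈ E, e.2 < m) (hO : ∀ o ∈ O, o < m) (ha : a ∈ O) :
    diagramCr (insert (a, m) E) (O.erase a) = diagramCr E O + #{o ∈ O | a < o} := by
  have hnew : (a, m) ∉ E := fun h => (hE _ h).false
  have harcs := card_filter_insert_product_insert hnew
    (fun e f => e.1 < f.1 ∧ f.1 < e.2 ∧ e.2 < f.2) (by simp)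
  have hhalf := card_filter_insert_product hnew (O.erase a) (fun e o => e.1 < o ∧ o < e.2)
  have herase := card_filter_product_erase_add E ha (fun e o => e.1 < o ∧ o < e.2)
  have hcrossed : {e ∈ E | e.1 < a ∧ a < e.2 ∧ e.2 < m} = {e ∈ E | e.1 < a ∧ a < e.2} := by grind
  have hcrossing : {e ∈ E | a < e.1 ∧ e.1 < m ∧ m < e.2} = ∅ := by grind
  have hopen : {o ∈ O.erase a | a < o ∧ o < m} = {o ∈ O | a < o} := by grind
  simp only [hcrossed, hcrossing, hopen, card_empty] at harcs hhalf
  simp only [diagramCr]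
  omega

theorem diagramNe_close (hE : ∀ e ∈ E, e.1 < e.2 ∧ e.2 < m) (ha : a ∈ O) :
    diagramNe (insert (a, m) E) (O.erase a) = diagramNe E O + #{o ∈ O | o < a} := by
  have hnew : (a, m) ∉ E := fun h => (hE _ h).2.false
  have harcs := card_filter_insert_product_insert hnew
    (fun e f => e.1 < f.1 ∧ f.1 < f.2 ∧ f.2 < e.2) (by simp)
  have hhalf := card_filter_insert_product hnew (O.erase a) (fun e o => o < e.1)
  have herase := card_filter_product_erase_add E ha (fun e o => o < e.1)
  have hnested : {e ∈ E | a < e.1 ∧ e.1 < e.2 ∧ e.2 < m} = {e ∈ E | a < e.1} := by grind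
  have hnesting : {e ∈ E | e.1 < a ∧ a < m ∧ m < e.2} = ∅ := by grind
  have hopen : {o ∈ O.erase a | o < a} = {o ∈ O | o < a} := by grind
  simp only [hnested, hnesting, hopen, card_empty] at harcs hhalf
  simp only [diagramNe]
  omega

/-- The points at which an arc or a half-arc of a diagram starts. -/
def diagramStarts (E : Finset (α × α)) (O : Finset α) : Finset α :=
  E.image Prod.fst ∪ O

/-- The points at which an arc ends. -/
def arcEnds (E : Finset (α × α)) : Finset α :=
  E.image Prod.snd

theorem diagramStarts_insert_halfArc :
    diagramStarts E (insert m O) = insert m (diagramStarts E O) :=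
  union_insert ..

theorem diagramStarts_close (ha : a ∈ O) :
    diagramStarts (insert (a, m) E) (O.erase a) = diagramStarts E O := by
  rw [diagramStarts, image_insert, insert_union, ← union_insert, insert_erase ha, diagramStarts]

theorem arcEnds_insert : arcEnds (insert (a, m) E) = insert m (arcEnds E) :=
  image_insert ..

theorem notMem_diagramStarts (hE : ∀ e ∈ E, e.1 < m) (hO : ∀ o ∈ O, o < m) :
    m ∉ diagramStarts E O := by
  rw [diagramStarts]
  grind

theorem notMem_arcEnds (hE : ∀ e ∈ E, e.2 < m) : m ∉ arcEnds E := by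
  rw [arcEnds]
  grind

/-- The points of `s` at which no arc of `E` starts. For the arcs of a partition of `s`, these are
the greatest elements of the blocks, see `mem_terminalPoints_blockArcs`. -/
def terminalPoints (s : Finset α) (E : Finset (α × α)) : Finset α :=
  s \ E.image Prod.fst

theorem terminalPoints_insert (hE : ∀ e ∈ E, e.1 < m) :
    terminalPoints (insert m s) E = insert m (terminalPoints s E) :=
  insert_sdiff_of_notMem s fun h => by
    obtain ⟨e, he, rfl⟩ := mem_image.1 h
    exact (hE e he).false

theorem terminalPoints_insert_insert (hE : ∀ e ∈ E, e.1 < m) (ham : a < m) :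
    terminalPoints (insert m s) (insert (a, m) E) = insert m ((terminalPoints s E).erase a) := by
  rw [terminalPoints, image_insert, sdiff_insert, ← terminalPoints, terminalPoints_insert hE,
    erase_insert_of_ne ham.ne']

section Weight

variable {R : Type*} [CommSemiring R] (p q u₁ u₂ v : R)

/-- The weight of the diagram on the points `s` with arcs `E` and half-arcs starting at `O`: a
factor `p` for each crossing, `q` for each nesting, `u₁` for each isolated point, `u₂` for each
point at which an arc ends and nothing starts, and `v` for each point at which an arc ends and an
arc or half-arc starts. -/
def diagramWeight (s : Finset α) (E : Finset (α × α)) (O : Finset α) : R :=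
  p ^ diagramCr E O * q ^ diagramNe E O * u₁ ^ #(s \ (diagramStarts E O ∪ arcEnds E)) *
    u₂ ^ #(arcEnds E \ diagramStarts E O) * v ^ #(arcEnds E ∩ diagramStarts E O)

theorem diagramWeight_insert (hs : m ∉ s) (hE : ∀ e ∈ E, e.1 < m ∧ e.2 < m)
    (hO : ∀ o ∈ O, o < m) :
    diagramWeight p q u₁ u₂ v (insert m s) E O = u₁ * diagramWeight p q u₁ u₂ v s E O := by
  have hstart := notMem_diagramStarts (fun e he => (hE e he).1) hO
  have hend := notMem_arcEnds fun e he => (hE e he).2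
  rw [diagramWeight, diagramWeight, insert_sdiff_of_notMem _ (by simp [hstart, hend]),
    card_insert_of_notMem fun h => hs (mem_sdiff.1 h).1]
  ring

theorem diagramWeight_insert_open (hs : m ∉ s) (hE : ∀ e ∈ E, e.1 < m ∧ e.2 < m) :
    diagramWeight p q u₁ u₂ v (insert m s) E (insert m O) = diagramWeight p q u₁ u₂ v s E O := by
  have hend := notMem_arcEnds fun e he => (hE e he).2
  rw [diagramWeight, diagramWeight, diagramCr_insert_halfArc fun e he => (hE e he).2.le,
    diagramNe_insert_halfArc fun e he => (hE e he).1.le, diagramStarts_insert_halfArc,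
    insert_union, insert_sdiff_insert, sdiff_insert_of_notMem hs, sdiff_insert_of_notMem hend,
    inter_insert_of_notMem hend]

theorem diagramWeight_insert_close (hs : m ∉ s) (hE : ∀ e ∈ E, e.1 < e.2 ∧ e.2 < m)
    (hO : ∀ o ∈ O, o < m) (ha : a ∈ O) :
    diagramWeight p q u₁ u₂ v (insert m s) (insert (a, m) E) (O.erase a) =
      u₂ * (p ^ #{o ∈ O | a < o} * q ^ #{o ∈ O | o < a}) *
        diagramWeight p q u₁ u₂ v s E O := by
  have hstart := notMem_diagramStarts (fun e he => (hE e he).1.trans (hE e he).2) hO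
  have hend := notMem_arcEnds fun e he => (hE e he).2
  rw [diagramWeight, diagramWeight, diagramCr_close (fun e he => (hE e he).2) hO ha,
    diagramNe_close hE ha, diagramStarts_close ha, arcEnds_insert, union_insert,
    insert_sdiff_insert, sdiff_insert_of_notMem hs, insert_sdiff_of_notMem _ hstart,
    card_insert_of_notMem fun h => hend (mem_sdiff.1 h).1, insert_inter_of_notMem hstart]
  ring

theorem diagramWeight_insert_transient (hs : m ∉ s) (hE : ∀ e ∈ E, e.1 < e.2 ∧ e.2 < m)
    (hO : ∀ o ∈ O, o < m) (ha : a ∈ O) :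
    diagramWeight p q u₁ u₂ v (insert m s) (insert (a, m) E) (insert m (O.erase a)) =
      v * (p ^ #{o ∈ O | a < o} * q ^ #{o ∈ O | o < a}) *
        diagramWeight p q u₁ u₂ v s E O := by
  have hend := notMem_arcEnds fun e he => (hE e he).2
  have hE' : ∀ e ∈ insert (a, m) E, e.1 ≤ m ∧ e.2 ≤ m := by grind
  rw [diagramWeight, diagramWeight, diagramCr_insert_halfArc fun e he => (hE' e he).2,
    diagramNe_insert_halfArc fun e he => (hE' e he).1,
    diagramCr_close (fun e he => (hE e he).2) hO ha, diagramNe_close hE ha,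
    diagramStarts_insert_halfArc, diagramStarts_close ha, arcEnds_insert, ← insert_union_distrib,
    insert_sdiff_insert, sdiff_insert_of_notMem hs, insert_sdiff_insert,
    sdiff_insert_of_notMem hend, ← insert_inter_distrib,
    card_insert_of_notMem fun h => hend (mem_inter.1 h).1]
  ring

end Weight

section WeightSums

variable {R : Type*} [CommRing R] (p q : R) {T : Finset α}

theorem sum_sum_powersetCard_erase_eq_pqNumber_mul {f : α → Finset α → R} {g : Finset α → R}
    {w : R} (k : ℕ)
    (hf : ∀ O ⊆ T, ∀ a ∈ O,
      f a (O.erase a) = w * (p ^ #{o ∈ O | a < o} * q ^ #{o ∈ O | o < a}) * g O) :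
    ∑ a ∈ T, ∑ O ∈ powersetCard k (T.erase a), f a O =
      w * pqNumber p q (k + 1) * ∑ O ∈ powersetCard (k + 1) T, g O := by
  rw [sum_sum_powersetCard_erase, mul_sum]
  refine sum_congr rfl fun O hO => ?_
  obtain ⟨hOT, hcard⟩ := mem_powersetCard.1 hO
  rw [← hcard, ← sum_pow_card_gt_mul_pow_card_lt, mul_sum, sum_mul]
  exact sum_congr rfl fun a ha => hf O hOT a ha

variable (u₁ u₂ v : R)

theorem sum_diagramWeight_insert_close (hs : m ∉ s) (hE : ∀ e ∈ E, e.1 < e.2 ∧ e.2 < m)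
    (hT : ∀ o ∈ T, o < m) (k : ℕ) :
    ∑ a ∈ T, ∑ O ∈ powersetCard k (T.erase a),
        diagramWeight p q u₁ u₂ v (insert m s) (insert (a, m) E) O =
      u₂ * pqNumber p q (k + 1) *
        ∑ O ∈ powersetCard (k + 1) T, diagramWeight p q u₁ u₂ v s E O :=
  sum_sum_powersetCard_erase_eq_pqNumber_mul p q k fun _ hO _ ha =>
    diagramWeight_insert_close p q u₁ u₂ v hs hE (fun o ho => hT o (hO ho)) ha

theorem sum_diagramWeight_insert_transient (hs : m ∉ s) (hE : ∀ e ∈ E, e.1 < e.2 ∧ e.2 < m)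
    (hT : ∀ o ∈ T, o < m) (k : ℕ) :
    ∑ a ∈ T, ∑ O ∈ powersetCard k (T.erase a),
        diagramWeight p q u₁ u₂ v (insert m s) (insert (a, m) E) (insert m O) =
      v * pqNumber p q (k + 1) *
        ∑ O ∈ powersetCard (k + 1) T, diagramWeight p q u₁ u₂ v s E O :=
  sum_sum_powersetCard_erase_eq_pqNumber_mul p q k fun _ hO _ ha =>
    diagramWeight_insert_transient p q u₁ u₂ v hs hE (fun o ho => hT o (hO ho)) ha

/-- The sum of the weights of the diagrams on the points `s` with arcs `E` and `k` half-arcs, which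
may start at the points where no arc of `E` starts. -/
def openDiagramSum (s : Finset α) (E : Finset (α × α)) (k : ℕ) : R :=
  ∑ O ∈ powersetCard k (terminalPoints s E), diagramWeight p q u₁ u₂ v s E O

theorem openDiagramSum_insert_zero (hs : ∀ x ∈ s, x < m) (hE : ∀ e ∈ E, e.1 < e.2 ∧ e.2 < m) :
    openDiagramSum p q u₁ u₂ v (insert m s) E 0 +
        ∑ a ∈ terminalPoints s E, openDiagramSum p q u₁ u₂ v (insert m s) (insert (a, m) E) 0 =
      u₁ * openDiagramSum p q u₁ u₂ v s E 0 +
        u₂ * pqNumber p q 1 * openDiagramSum p q u₁ u₂ v s E 1 := by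
  have hms : m ∉ s := fun h => (hs m h).false
  have hE' : ∀ e ∈ E, e.1 < m ∧ e.2 < m := fun e he => ⟨(hE e he).1.trans (hE e he).2, (hE e he).2⟩
  have hT : ∀ x ∈ terminalPoints s E, x < m := fun x hx => hs x (mem_sdiff.1 hx).1
  have hclose := sum_diagramWeight_insert_close p q u₁ u₂ v hms hE hT 0
  simp only [powersetCard_zero, sum_singleton] at hclose
  simp only [openDiagramSum, powersetCard_zero, sum_singleton, hclose]
  rw [diagramWeight_insert p q u₁ u₂ v hms hE' (by simp)]

theorem openDiagramSum_insert_succ (hs : ∀ x ∈ s, x < m) (hE : ∀ e ∈ E, e.1 < e.2 ∧ e.2 < m)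
    (k : ℕ) :
    openDiagramSum p q u₁ u₂ v (insert m s) E (k + 1) +
        ∑ a ∈ terminalPoints s E,
          openDiagramSum p q u₁ u₂ v (insert m s) (insert (a, m) E) (k + 1) =
      openDiagramSum p q u₁ u₂ v s E k +
        (u₁ + pqNumber p q (k + 1) * v) * openDiagramSum p q u₁ u₂ v s E (k + 1) +
        u₂ * pqNumber p q (k + 2) * openDiagramSum p q u₁ u₂ v s E (k + 2) := by
  have hms : m ∉ s := fun h => (hs m h).false
  have hE' : ∀ e ∈ E, e.1 < m ∧ e.2 < m := fun e he => ⟨(hE e he).1.trans (hE e he).2, (hE e he).2⟩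
  have hT : ∀ x ∈ terminalPoints s E, x < m := fun x hx => hs x (mem_sdiff.1 hx).1
  have hmT : m ∉ terminalPoints s E := fun h => (hT m h).false
  have hunmatched : openDiagramSum p q u₁ u₂ v (insert m s) E (k + 1) =
      u₁ * openDiagramSum p q u₁ u₂ v s E (k + 1) + openDiagramSum p q u₁ u₂ v s E k := by
    rw [openDiagramSum, terminalPoints_insert fun e he => (hE' e he).1,
      sum_powersetCard_succ_insert hmT, openDiagramSum, mul_sum]
    congr 1
    · exact sum_congr rfl fun O hO => diagramWeight_insert p q u₁ u₂ v hms hE'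
        fun o ho => hT o ((mem_powersetCard.1 hO).1 ho)
    · exact sum_congr rfl fun O _ => diagramWeight_insert_open p q u₁ u₂ v hms hE'
  have hmatched : ∑ a ∈ terminalPoints s E,
        openDiagramSum p q u₁ u₂ v (insert m s) (insert (a, m) E) (k + 1) =
      u₂ * pqNumber p q (k + 2) * openDiagramSum p q u₁ u₂ v s E (k + 2) +
        v * pqNumber p q (k + 1) * openDiagramSum p q u₁ u₂ v s E (k + 1) := by
    rw [openDiagramSum, ← sum_diagramWeight_insert_close p q u₁ u₂ v hms hE hT, openDiagramSum,
      ← sum_diagramWeight_insert_transient p q u₁ u₂ v hms hE hT, ← sum_add_distrib]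
    refine sum_congr rfl fun a ha => ?_
    rw [openDiagramSum, terminalPoints_insert_insert (fun e he => (hE' e he).1) (hT a ha),
      sum_powersetCard_succ_insert fun h => hmT (mem_of_mem_erase h)]
  rw [hunmatched, hmatched]
  ring

end WeightSums

end ArcDiagrams

section Insertion

variable {α : Type*} [DecidableEq α] {s B : Finset α} {a : α}

/-- The partition of `insert a s` obtained from a partition of `s` by removing the elements of
`B` from their blocks and adding the new block `insert a B`. For a block `B` of the partition, this
adds `a` to `B`; for `B = ∅`, it adds the singleton `{a}`. -/
def addBlock (π : Finpartition s) (ha : a ∉ s) (hB : B ⊆ s) : Finpartition (insert a s) :=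
  (π.avoid B).extend (b := insert a B) (insert_ne_empty a B)
    (disjoint_insert_right.2 ⟨fun h => ha (mem_sdiff.1 h).1, sdiff_disjoint⟩)
    (by rw [sup_eq_union, union_insert, sdiff_union_of_subset hB])

theorem subset_of_mem_insert_empty_parts {π : Finpartition s} (hB : B ∈ insert ∅ π.parts) :
    B ⊆ s :=
  (mem_insert.1 hB).elim (fun h => h ▸ empty_subset s) π.subset

theorem parts_avoid_of_mem {π : Finpartition s} (hB : B ∈ insert ∅ π.parts) :
    (π.avoid B).parts = π.parts.erase B := by
  have hdisj : ∀ C ∈ π.parts, C ≠ B → Disjoint C B := by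
    intro C hC hCB
    rcases mem_insert.1 hB with rfl | hB
    · exact disjoint_empty_right C
    · exact π.disjoint hC hB hCB
  ext C
  rw [Finpartition.mem_avoid, mem_erase]
  constructor
  · rintro ⟨D, hD, hDB, rfl⟩
    have hne : D ≠ B := fun h => hDB h.le
    rw [(hdisj D hD hne).sdiff_eq_left]
    exact ⟨hne, hD⟩
  · rintro ⟨hCB, hC⟩
    exact ⟨C, hC, fun h => π.ne_empty hC ((hdisj C hC hCB).eq_bot_of_le h),
      (hdisj C hC hCB).sdiff_eq_left⟩

theorem parts_addBlock {π : Finpartition s} (ha : a ∉ s) (hB : B ∈ insert ∅ π.parts) :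
    (addBlock π ha (subset_of_mem_insert_empty_parts hB)).parts =
      insert (insert a B) (π.parts.erase B) :=
  congrArg (insert (insert a B)) (parts_avoid_of_mem hB)

theorem part_erase_addBlock (π : Finpartition s) (ha : a ∉ s) (hB : B ⊆ s) :
    ((addBlock π ha hB).part a).erase a = B := by
  rw [Finpartition.part_eq_of_mem _ (mem_insert_self (insert a B) _) (mem_insert_self a B),
    erase_insert fun h => ha (hB h)]

theorem mem_parts_restrict {t C : Finset α} (π : Finpartition t) (hs : s ⊆ t) :
    C ∈ (π.restrict hs).parts ↔ C ≠ ∅ ∧ ∃ D ∈ π.parts, D ∩ s = C := by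
  simp only [Finpartition.restrict, mem_erase, mem_image, bot_eq_empty, inf_eq_inter]

theorem restrict_addBlock {π : Finpartition s} (ha : a ∉ s) (hB : B ∈ insert ∅ π.parts) :
    (addBlock π ha (subset_of_mem_insert_empty_parts hB)).restrict (subset_insert a s) = π := by
  have hinter : insert a B ∩ s = B := by
    rw [insert_inter_of_notMem ha, inter_eq_left.2 (subset_of_mem_insert_empty_parts hB)]
  ext1
  ext C
  rw [mem_parts_restrict, parts_addBlock ha hB]
  constructor
  · rintro ⟨hC, D, hD, rfl⟩
    rcases mem_insert.1 hD with rfl | hD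
    · rw [hinter] at hC ⊢
      exact (mem_insert.1 hB).resolve_left hC
    · rw [inter_eq_left.2 (π.subset (mem_of_mem_erase hD))]
      exact mem_of_mem_erase hD
  · intro hC
    refine ⟨π.ne_empty hC, ?_⟩
    by_cases hCB : C = B
    · exact ⟨insert a B, mem_insert_self _ _, hinter.trans hCB.symm⟩
    · exact ⟨C, mem_insert_of_mem (mem_erase.2 ⟨hCB, hC⟩), inter_eq_left.2 (π.subset hC)⟩

theorem inter_eq_erase_of_subset_insert {t : Finset α} (ha : a ∉ s) (ht : t ⊆ insert a s) :
    t ∩ s = t.erase a := by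
  rw [← erase_insert ha, inter_erase, inter_eq_left.2 ht]

theorem part_erase_mem_restrict (ha : a ∉ s) (π : Finpartition (insert a s)) :
    (π.part a).erase a ∈ insert ∅ (π.restrict (subset_insert a s)).parts := by
  rw [mem_insert, mem_parts_restrict, or_iff_not_imp_left]
  exact fun h => ⟨h, π.part a, π.part_mem.2 (mem_insert_self a s),
    inter_eq_erase_of_subset_insert ha (π.part_subset a)⟩

theorem addBlock_restrict (ha : a ∉ s) (π : Finpartition (insert a s)) :
    addBlock (π.restrict (subset_insert a s)) ha
      (subset_of_mem_insert_empty_parts (part_erase_mem_restrict ha π)) = π := by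
  have hmem : a ∈ π.part a := π.mem_part (mem_insert_self a s)
  have hpart : π.part a ∈ π.parts := π.part_mem.2 (mem_insert_self a s)
  have hinter {D : Finset α} (hD : D ∈ π.parts) : D ∩ s = D.erase a :=
    inter_eq_erase_of_subset_insert ha (π.subset hD)
  have hnot {D : Finset α} (hD : D ∈ π.parts) (hne : D ≠ π.part a) : a ∉ D :=
    fun h => hne (π.part_eq_of_mem hD h).symm
  ext1
  ext C
  rw [parts_addBlock ha (part_erase_mem_restrict ha π), insert_erase hmem, mem_insert,
    mem_erase, mem_parts_restrict]
  constructor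
  · rintro (rfl | ⟨hne, -, D, hD, rfl⟩)
    · exact hpart
    · rw [hinter hD] at hne ⊢
      rwa [erase_eq_of_notMem (hnot hD fun h => hne (by rw [h]))]
  · intro hC
    by_cases hCa : C = π.part a
    · exact Or.inl hCa
    · obtain ⟨x, hx⟩ := π.nonempty_of_mem_parts hC
      refine Or.inr ⟨fun h => hCa (π.eq_of_mem_parts hC hpart hx (mem_of_mem_erase (h ▸ hx))),
        π.ne_empty hC, C, hC, ?_⟩
      rw [hinter hC, erase_eq_of_notMem (hnot hC hCa)]

theorem sum_finpartition_insert {M : Type*} [AddCommMonoid M] (ha : a ∉ s)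
    (f : Finset (Finset α) → M) :
    ∑ π : Finpartition (insert a s), f π.parts =
      ∑ π : Finpartition s, ∑ B ∈ insert ∅ π.parts,
        f (insert (insert a B) (π.parts.erase B)) := by
  rw [sum_sigma']
  symm
  refine sum_bij'
    (fun x hx => addBlock x.1 ha (subset_of_mem_insert_empty_parts (mem_sigma.1 hx).2))
    (fun π _ => ⟨π.restrict (subset_insert a s), (π.part a).erase a⟩)
    (fun _ _ => mem_univ _)
    (fun π _ => mem_sigma.2 ⟨mem_univ _, part_erase_mem_restrict ha π⟩) ?_ ?_ ?_
  · rintro ⟨π, B⟩ hx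
    simp only [restrict_addBlock ha (mem_sigma.1 hx).2, part_erase_addBlock]
  · exact fun π _ => addBlock_restrict ha π
  · rintro ⟨π, B⟩ hx
    rw [parts_addBlock ha (mem_sigma.1 hx).2]

end Insertion

section BlockArcs

variable {α : Type*} [LinearOrder α]

/-- The pairs of consecutive elements of a finite set, smaller element first. -/
def consecutivePairs (B : Finset α) : Finset (α × α) :=
  {e ∈ B ×ˢ B | e.1 < e.2 ∧ ∀ x ∈ B, ¬(e.1 < x ∧ x < e.2)}

/-- The arcs of a family of blocks: the pairs of consecutive elements of a block. -/
def blockArcs (P : Finset (Finset α)) : Finset (α × α) :=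
  P.biUnion consecutivePairs

variable {s B : Finset α} {a m x y : α}

theorem mem_consecutivePairs :
    (x, y) ∈ consecutivePairs B ↔
      x ∈ B ∧ y ∈ B ∧ x < y ∧ ∀ z ∈ B, ¬(x < z ∧ z < y) := by
  rw [consecutivePairs, mem_filter, mem_product, and_assoc]

theorem exists_mem_consecutivePairs_right (hx : x ∈ B) :
    (∃ y, (x, y) ∈ consecutivePairs B) ↔ ∃ y ∈ B, x < y := by
  refine ⟨fun ⟨y, h⟩ => ⟨y, (mem_consecutivePairs.1 h).2.1, (mem_consecutivePairs.1 h).2.2.1⟩,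
    fun ⟨y, hy, hxy⟩ => ?_⟩
  have hne : {z ∈ B | x < z}.Nonempty := ⟨y, mem_filter.2 ⟨hy, hxy⟩⟩
  obtain ⟨hB, hlt⟩ := mem_filter.1 (min'_mem _ hne)
  exact ⟨_, mem_consecutivePairs.2 ⟨hx, hB, hlt, fun z hz hxz =>
    (min'_le _ z (mem_filter.2 ⟨hz, hxz.1⟩)).not_gt hxz.2⟩⟩

theorem exists_mem_consecutivePairs_left (hy : y ∈ B) :
    (∃ x, (x, y) ∈ consecutivePairs B) ↔ ∃ x ∈ B, x < y := by
  refine ⟨fun ⟨x, h⟩ => ⟨x, (mem_consecutivePairs.1 h).1, (mem_consecutivePairs.1 h).2.2.1⟩,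
    fun ⟨x, hx, hxy⟩ => ?_⟩
  have hne : {z ∈ B | z < y}.Nonempty := ⟨x, mem_filter.2 ⟨hx, hxy⟩⟩
  obtain ⟨hB, hlt⟩ := mem_filter.1 (max'_mem _ hne)
  exact ⟨_, mem_consecutivePairs.2 ⟨hB, hy, hlt, fun z hz hzy =>
    (le_max' _ z (mem_filter.2 ⟨hz, hzy.2⟩)).not_gt hzy.1⟩⟩

theorem consecutivePairs_insert (ha : IsGreatest (B : Set α) a) (ham : a < m) :
    consecutivePairs (insert m B) = insert (a, m) (consecutivePairs B) := by
  have hlt : ∀ x ∈ B, x < m := fun x hx => (ha.2 hx).trans_lt ham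
  have haB : a ∈ B := ha.1
  have hle : ∀ x ∈ B, x ≤ a := fun x hx => ha.2 hx
  ext ⟨x, y⟩
  rw [mem_insert, mem_consecutivePairs, mem_consecutivePairs]
  grind

theorem blockArcs_insert_singleton (P : Finset (Finset α)) :
    blockArcs (insert {m} P) = blockArcs P := by
  have hempty : consecutivePairs {m} = ∅ := by
    grind [consecutivePairs]
  rw [blockArcs, biUnion_insert, hempty, empty_union, blockArcs]

theorem blockArcs_insert_insert {P : Finset (Finset α)} (hB : B ∈ P)
    (ha : IsGreatest (B : Set α) a) (ham : a < m) :
    blockArcs (insert (insert m B) (P.erase B)) = insert (a, m) (blockArcs P) := by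
  rw [blockArcs, biUnion_insert, consecutivePairs_insert ha ham, insert_union, ← biUnion_insert,
    insert_erase hB, blockArcs]

section PartitionArcs

variable (π : Finpartition s)

theorem mem_image_fst_blockArcs (hB : B ∈ π.parts) (hx : x ∈ B) :
    x ∈ (blockArcs π.parts).image Prod.fst ↔ ∃ y ∈ B, x < y := by
  rw [← exists_mem_consecutivePairs_right hx, mem_image]
  constructor
  · rintro ⟨⟨z, y⟩, he, rfl⟩
    obtain ⟨C, hC, he⟩ := mem_biUnion.1 he
    obtain rfl := π.eq_of_mem_parts hB hC hx (mem_consecutivePairs.1 he).1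
    exact ⟨y, he⟩
  · exact fun ⟨y, h⟩ => ⟨(x, y), mem_biUnion.2 ⟨B, hB, h⟩, rfl⟩

theorem mem_arcEnds_blockArcs (hB : B ∈ π.parts) (hx : x ∈ B) :
    x ∈ arcEnds (blockArcs π.parts) ↔ ∃ y ∈ B, y < x := by
  rw [← exists_mem_consecutivePairs_left hx, arcEnds, mem_image]
  constructor
  · rintro ⟨⟨y, z⟩, he, rfl⟩
    obtain ⟨C, hC, he⟩ := mem_biUnion.1 he
    obtain rfl := π.eq_of_mem_parts hB hC hx (mem_consecutivePairs.1 he).2.1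
    exact ⟨y, he⟩
  · exact fun ⟨y, h⟩ => ⟨(y, x), mem_biUnion.2 ⟨B, hB, h⟩, rfl⟩

theorem mem_terminalPoints_blockArcs (hB : B ∈ π.parts) (hx : x ∈ B) :
    x ∈ terminalPoints s (blockArcs π.parts) ↔ IsGreatest (B : Set α) x := by
  rw [terminalPoints, mem_sdiff, mem_image_fst_blockArcs π hB hx, and_iff_right (π.subset hB hx)]
  simp only [not_exists, not_and, not_lt, IsGreatest, mem_coe, hx, true_and, upperBounds,
    Set.mem_ofPred_eq]

theorem sum_part_terminalPoints {M : Type*} [AddCommMonoid M] (f : Finset α → M) :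
    ∑ a ∈ terminalPoints s (blockArcs π.parts), f (π.part a) = ∑ B ∈ π.parts, f B := by
  have hgreatest {a} (ha : a ∈ terminalPoints s (blockArcs π.parts)) :
      IsGreatest (π.part a : Set α) a :=
    have has := (mem_sdiff.1 ha).1
    (mem_terminalPoints_blockArcs π (π.part_mem.2 has) (π.mem_part has)).1 ha
  refine sum_nbij π.part (fun a ha => π.part_mem.2 (mem_sdiff.1 ha).1)
    (fun a ha b hb hab => ?_) (fun B hB => ?_) fun _ _ => rfl
  · exact (hgreatest ha).unique (hab ▸ hgreatest hb)
  · have ha := B.isGreatest_max' (π.nonempty_of_mem_parts hB)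
    exact ⟨_, (mem_terminalPoints_blockArcs π hB ha.1).2 ha, π.part_eq_of_mem hB ha.1⟩

theorem mem_of_mem_blockArcs {e : α × α} (he : e ∈ blockArcs π.parts) :
    e.1 ∈ s ∧ e.2 ∈ s ∧ e.1 < e.2 := by
  obtain ⟨B, hB, he⟩ := mem_biUnion.1 he
  obtain ⟨h₁, h₂, hlt, -⟩ := mem_consecutivePairs.1 he
  exact ⟨π.subset hB h₁, π.subset hB h₂, hlt⟩

theorem arcEnds_blockArcs_subset : arcEnds (blockArcs π.parts) ⊆ s := by
  intro x hx
  obtain ⟨e, he, rfl⟩ := mem_image.1 hx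
  exact (mem_of_mem_blockArcs π he).2.1

end PartitionArcs

theorem sum_finpartition_insert_blockArcs {M : Type*} [AddCommMonoid M] (hm : ∀ x ∈ s, x < m)
    (f : Finset (α × α) → M) :
    ∑ π : Finpartition (insert m s), f (blockArcs π.parts) =
      ∑ π : Finpartition s, (f (blockArcs π.parts) +
        ∑ a ∈ terminalPoints s (blockArcs π.parts), f (insert (a, m) (blockArcs π.parts))) := by
  rw [sum_finpartition_insert (fun h => (hm m h).false) fun P => f (blockArcs P)]
  refine sum_congr rfl fun π _ => ?_
  rw [sum_insert π.empty_notMem_parts, insert_empty_eq, blockArcs_insert_singleton,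
    erase_eq_of_notMem π.empty_notMem_parts, ← sum_part_terminalPoints]
  congr 1
  refine sum_congr rfl fun a ha => ?_
  have has := (mem_sdiff.1 ha).1
  have hpart := π.part_mem.2 has
  rw [blockArcs_insert_insert hpart
    ((mem_terminalPoints_blockArcs π hpart (π.mem_part has)).1 ha) (hm a has)]

end BlockArcs

section OpenPartitions

variable {α R : Type*} [LinearOrder α] [CommRing R] (p q u₁ u₂ v : R)

/-- The sum of the weights of the partitions of `s` in which `k` blocks are marked as open: the
greatest element of an open block starts a half-arc. -/
def openBell (s : Finset α) (k : ℕ) : R :=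
  ∑ π : Finpartition s, openDiagramSum p q u₁ u₂ v s (blockArcs π.parts) k

theorem openBell_empty (k : ℕ) :
    openBell p q u₁ u₂ v (∅ : Finset α) k = if k = 0 then 1 else 0 := by
  let _ : Unique (Finpartition (∅ : Finset α)) :=
    inferInstanceAs (Unique (Finpartition (⊥ : Finset α)))
  have hparts : (default : Finpartition (∅ : Finset α)).parts = ∅ :=
    Finpartition.parts_eq_empty_iff.2 rfl
  rw [openBell, Fintype.sum_unique, hparts]
  cases k <;> simp [openDiagramSum, terminalPoints, diagramWeight, diagramCr, diagramNe, blockArcs,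
    arcEnds]

variable {s : Finset α} {m : α}

theorem openBell_insert_zero (hm : ∀ x ∈ s, x < m) :
    openBell p q u₁ u₂ v (insert m s) 0 =
      u₁ * openBell p q u₁ u₂ v s 0 + u₂ * pqNumber p q 1 * openBell p q u₁ u₂ v s 1 := by
  rw [openBell, sum_finpartition_insert_blockArcs hm
    fun E => openDiagramSum p q u₁ u₂ v (insert m s) E 0]
  simp only [openBell, mul_sum, ← sum_add_distrib]
  refine sum_congr rfl fun π _ => openDiagramSum_insert_zero p q u₁ u₂ v hm fun e he => ?_
  obtain ⟨-, hs, hlt⟩ := mem_of_mem_blockArcs π he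
  exact ⟨hlt, hm _ hs⟩

theorem openBell_insert_succ (hm : ∀ x ∈ s, x < m) (k : ℕ) :
    openBell p q u₁ u₂ v (insert m s) (k + 1) =
      openBell p q u₁ u₂ v s k +
        (u₁ + pqNumber p q (k + 1) * v) * openBell p q u₁ u₂ v s (k + 1) +
        u₂ * pqNumber p q (k + 2) * openBell p q u₁ u₂ v s (k + 2) := by
  rw [openBell, sum_finpartition_insert_blockArcs hm
    fun E => openDiagramSum p q u₁ u₂ v (insert m s) E (k + 1)]
  simp only [openBell, mul_sum, ← sum_add_distrib]
  refine sum_congr rfl fun π _ => openDiagramSum_insert_succ p q u₁ u₂ v hm (fun e he => ?_) k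
  obtain ⟨-, hs, hlt⟩ := mem_of_mem_blockArcs π he
  exact ⟨hlt, hm _ hs⟩

theorem openBell_eq_motzkinSum (s : Finset α) (k : ℕ) :
    openBell p q u₁ u₂ v s k =
      motzkinSum (fun k => u₁ + pqNumber p q k * v) (fun k => u₂ * pqNumber p q (k + 1)) #s k := by
  induction s using Finset.induction_on_max generalizing k with
  | empty => cases k <;> simp [openBell_empty, motzkinSum]
  | insert m s hm ih =>
    rw [card_insert_of_notMem fun h => (hm m h).false]
    cases k with
    | zero =>
      rw [openBell_insert_zero p q u₁ u₂ v hm, ih, ih, motzkinSum]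
      simp [pqNumber]
    | succ k => rw [openBell_insert_succ p q u₁ u₂ v hm, ih, ih, ih, motzkinSum]

end OpenPartitions

namespace SetPartition

variable {n : ℕ} (π : SetPartition n)

theorem edges_eq_blockArcs : π.edges = blockArcs π.parts := by
  ext ⟨x, y⟩
  simp only [edges, blockArcs, mem_filter, mem_product, mem_biUnion, mem_consecutivePairs]
  constructor
  · rintro ⟨-, hlt, B, hB, hx, hy, hmid⟩
    exact ⟨B, hB, hx, hy, hlt, hmid⟩
  · rintro ⟨B, hB, hx, hy, hlt, hmid⟩
    exact ⟨⟨π.subset hB hx, π.subset hB hy⟩, hlt, B, hB, hx, hy, hmid⟩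

theorem cr_eq_diagramCr : π.cr = diagramCr (blockArcs π.parts) ∅ := by
  rw [cr, diagramCr, edges_eq_blockArcs, product_empty, filter_empty, card_empty, add_zero]

theorem ne_eq_diagramNe : π.ne = diagramNe (blockArcs π.parts) ∅ := by
  rw [ne, diagramNe, edges_eq_blockArcs, product_empty, filter_empty, card_empty, add_zero]

theorem sg_eq_card_sdiff :
    π.sg = #(Icc 1 n \ (diagramStarts (blockArcs π.parts) ∅ ∪ arcEnds (blockArcs π.parts))) := by
  rw [sg, ← filter_notMem_eq_sdiff, diagramStarts, union_empty]
  congr 1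
  refine filter_congr fun x hx => ?_
  obtain ⟨B, hB, hxB⟩ := π.exists_mem hx
  rw [mem_union, mem_image_fst_blockArcs π hB hxB, mem_arcEnds_blockArcs π hB hxB]
  constructor
  · intro h
    obtain rfl := π.eq_of_mem_parts h hB (mem_singleton_self x) hxB
    simp
  · intro h
    push Not at h
    have : B = {x} := eq_singleton_iff_unique_mem.2
      ⟨hxB, fun y hy => le_antisymm (h.1 y hy) (h.2 y hy)⟩
    exact this ▸ hB

theorem tr_eq_card_inter :
    π.tr = #(arcEnds (blockArcs π.parts) ∩ diagramStarts (blockArcs π.parts) ∅) := by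
  rw [tr, diagramStarts, union_empty]
  congr 1
  ext x
  rw [mem_filter, mem_inter]
  constructor
  · rintro ⟨-, B, hB, -, hxB, hend, hstart⟩
    exact ⟨(mem_arcEnds_blockArcs π hB hxB).2 hend, (mem_image_fst_blockArcs π hB hxB).2 hstart⟩
  · rintro ⟨hend, hstart⟩
    have hx := arcEnds_blockArcs_subset π hend
    obtain ⟨B, hB, hxB⟩ := π.exists_mem hx
    rw [mem_arcEnds_blockArcs π hB hxB] at hend
    obtain ⟨y, hy, hyx⟩ := hend
    exact ⟨hx, B, hB, one_lt_card.2 ⟨x, hxB, y, hy, hyx.ne'⟩, hxB, ⟨y, hy, hyx⟩,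
      (mem_image_fst_blockArcs π hB hxB).1 hstart⟩

theorem bl_eq_card_sdiff :
    π.bl = #(arcEnds (blockArcs π.parts) \ diagramStarts (blockArcs π.parts) ∅) := by
  have hcard {a} (ha : a ∈ terminalPoints (Icc 1 n) (blockArcs π.parts)) :
      2 ≤ #(π.part a) ↔ a ∈ arcEnds (blockArcs π.parts) := by
    have has := (mem_sdiff.1 ha).1
    have hB := π.part_mem.2 has
    have haB := π.mem_part has
    have hgreatest := (mem_terminalPoints_blockArcs π hB haB).1 ha
    rw [mem_arcEnds_blockArcs π hB haB]
    constructor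
    · intro h
      obtain ⟨y, hy, hne⟩ := exists_mem_ne h a
      exact ⟨y, hy, (hgreatest.2 hy).lt_of_ne hne⟩
    · exact fun ⟨y, hy, hya⟩ => one_lt_card.2 ⟨a, haB, y, hy, hya.ne'⟩
  rw [bl, card_filter, ← sum_part_terminalPoints π fun B => if 2 ≤ #B then 1 else 0,
    ← card_filter, filter_congr fun a ha => hcard ha, terminalPoints, filter_mem_eq_inter,
    diagramStarts, union_empty, inter_comm, ← inter_sdiff_assoc,
    inter_eq_left.2 (arcEnds_blockArcs_subset π)]

end SetPartition

theorem bellPoly_eq_openBell {R : Type*} [CommRing R] (p q u₁ u₂ v : R) (n : ℕ) :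
    bellPoly p q u₁ u₂ v n = openBell p q u₁ u₂ v (Icc 1 n) 0 := by
  refine sum_congr rfl fun π _ => ?_
  rw [openDiagramSum, powersetCard_zero, sum_singleton, diagramWeight, π.cr_eq_diagramCr,
    π.ne_eq_diagramNe, π.sg_eq_card_sdiff, π.bl_eq_card_sdiff, π.tr_eq_card_inter]

theorem mainTheorem7 {R : Type*} [CommRing R] (p q u₁ u₂ v : R) :
    HasJFraction (PowerSeries.mk fun n => bellPoly p q u₁ u₂ v n)
      (fun k => u₁ + pqNumber p q k * v)
      (fun k => u₂ * pqNumber p q (k + 1)) := by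
  simp only [bellPoly_eq_openBell, openBell_eq_motzkinSum, Nat.card_Icc, Nat.add_sub_cancel]
  exact hasJFraction_motzkinSum _ _
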